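/- A \emph{strict PSI-algebra} is a Boolean algebra $(A,\vee,\wedge,\neg,0,1)$ together with a ternary operation $\Diamond$ such that, for all elements, $\Diamond(0,b,c)=\Diamond(a,0,c)=\Diamond(a,b,0)=0$; $\Diamond(a\vee x,b,c)=\Diamond(a,b,c)\vee\Diamond(x,b,c)$; $\Diamond(a,b\vee x,c)=\Diamond(a,b,c)\vee\Diamond(a,x,c)$; $\Diamond(a,b,c)\vee\Diamond(a,b,x)\le\Diamond(a,b,c\vee x)$; $\Diamond(a,b,f)\le\Diamond(a,b,\neg d)\vee\Diamond(a,b,\neg e)\vee\Diamond(d,e,f)$; $\Diamond(a,b,\neg a)=0$; $a\wedge f\le\Diamond(a,a,f)$; $\Diamond(a,b,f)\le\Diamond(b,a,f)$; $\Diamond(x,y,a)\wedge\neg\Diamond(x,y,b)\le\Diamond(1,1,a\wedge\neg b)$; $\Diamond(x,a,y)\wedge\neg\Diamond(x,b,y)\le\Diamond(1,a\wedge\neg b,1)$; $\Diamond(a,b,c)\le\mu(\Diamond(a,b,c))$, where $\mu(z)=\neg\Diamond(1,1,\neg z)\wedge\neg\Diamond(1,\neg z,1)$. Let $\mathcal{SPSI}$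 be the variety of strict PSI-algebras, in the language $\{\vee,\wedge,\neg,0,1,\Diamond\}$. Then: (1) $\mathcal{SPSI}$ has the congruence extension property: for every $\mathbf B\in\mathcal{SPSI}$, every subalgebra $\mathbf A$ of $\mathbf B$ and every congruence $\delta$ of $\mathbf A$ there is a congruence $\theta$ of $\mathbf B$ with $\delta=\theta\cap A^2$. (2) $\mathcal{SPSI}$ has equationally definable principal congruences: there is a finite conjunction $\zeta(x,y,u,v)$ of equations between terms such that for every $\mathbf A\in\mathcal{SPSI}$ and all $a,b,c,d\in A$, the pair $(c,d)$ lies in the smallest congruence of $\mathbf A$ containing $(a,b)$ if and only if $\mathbf A\models\zeta[a,b,c,d]$. (3) $\mathcal{SPSI}$ is arithmetical: for every $\mathbf A\in\mathcal{SPSI}$ the lattice of congruences of $\mathbf A$ is distributive, and any two congruences of $\mathbf A$ permute, that is, $\theta\circ\varphi=\varphi\circ\theta$. -/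

import Mathlib

universe u

/-! ### Universal algebra: congruences, CEP, EDPC, arithmeticity

Algebras are structures for a first-order language without relation symbols; classes of algebras
are sets of bundled structures. -/

namespace UnivAlg

/-- A congruence of the algebra `A`: an equivalence relation compatible with all basic
operations. -/
@[ext]
structure Congruence (L : FirstOrder.Language.{0, 0}) (A : Type u) [L.Structure A] extends Setoid A where
  compatible : ∀ {n : ℕ} (f : L.Functions n) (x y : Fin n → A),
    (∀ i, toSetoid (x i) (y i)) → toSetoid (FirstOrder.Language.Structure.funMap f x) (FirstOrder.Language.Structure.funMap f y)

namespace Congruence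

variable {L : FirstOrder.Language.{0, 0}} {A : Type u} [L.Structure A]

theorem toSetoid_injective :
    Function.Injective (toSetoid : Congruence L A → Setoid A) := by
  rintro ⟨r, _⟩ ⟨s, _⟩ h
  cases h
  rfl

/-- Congruences are ordered by inclusion. -/
instance : PartialOrder (Congruence L A) :=
  PartialOrder.lift toSetoid toSetoid_injective

/-- The infimum of a set of congruences is their intersection. -/
instance : InfSet (Congruence L A) where
  sInf S :=
    { toSetoid := sInf (toSetoid '' S)
      compatible := by
        rintro n f x y h _ ⟨θ, hθ, rfl⟩
        exact θ.compatible f x y fun i => h i _ ⟨θ, hθ, rfl⟩ }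

theorem isGLB_sInf (S : Set (Congruence L A)) : IsGLB S (sInf S) := by
  constructor
  · intro θ hθ x y h
    exact h _ ⟨θ, hθ, rfl⟩
  · rintro φ hφ x y h _ ⟨θ, hθ, rfl⟩
    exact hφ hθ h

/-- The congruence lattice of `A`. -/
instance : CompleteLattice (Congruence L A) :=
  completeLatticeOfInf _ isGLB_sInf

/-- The principal congruence `Cg(a, b)`: the smallest congruence containing `(a, b)`. -/
def principal (L : FirstOrder.Language.{0, 0}) {A : Type u} [L.Structure A] (a b : A) : Congruence L A :=
  sInf {θ | θ.toSetoid a b}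

end Congruence

variable {L : FirstOrder.Language.{0, 0}}

/-- The congruence extension property: every congruence `δ` of a subalgebra `S` of a member `B`
is the restriction `θ ∩ S²` of a congruence `θ` of `B`. -/
def HasCEP (V : Set (CategoryTheory.Bundled.{u} L.Structure)) : Prop :=
  ∀ B ∈ V, ∀ S : L.Substructure B, ∀ δ : Congruence L S,
    ∃ θ : Congruence L B, ∀ x y : S, δ.toSetoid x y ↔ θ.toSetoid (x : B) (y : B)

/-- Equationally definable principal congruences: one finite conjunction of equations in four
variables defines `(c, d) ∈ Cg(a, b)` in all members of the class. -/
def HasEDPC (V : Set (CategoryTheory.Bundled.{u} L.Structure)) : Prop :=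
  ∃ E : List (L.Term (Fin 4) × L.Term (Fin 4)), ∀ A ∈ V, ∀ a b c d : A,
    (Congruence.principal L a b).toSetoid c d ↔
      ∀ e ∈ E, e.1.realize ![a, b, c, d] = e.2.realize ![a, b, c, d]

/-- All congruence lattices of members of the class are distributive. -/
def IsCongruenceDistributive (V : Set (CategoryTheory.Bundled.{u} L.Structure)) : Prop :=
  ∀ A ∈ V, ∀ θ φ ψ : Congruence L A, θ ⊓ (φ ⊔ ψ) = (θ ⊓ φ) ⊔ (θ ⊓ ψ)

/-- Any two congruences of a member of the class permute: `θ ∘ φ = φ ∘ θ`. -/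
def IsCongruencePermutable (V : Set (CategoryTheory.Bundled.{u} L.Structure)) : Prop :=
  ∀ A ∈ V, ∀ θ φ : Congruence L A,
    Relation.Comp (⇑θ.toSetoid) (⇑φ.toSetoid) = Relation.Comp (⇑φ.toSetoid) (⇑θ.toSetoid)

/-- Arithmetical: congruence distributive and congruence permutable. -/
def IsArithmetical (V : Set (CategoryTheory.Bundled.{u} L.Structure)) : Prop :=
  IsCongruenceDistributive V ∧ IsCongruencePermutable V

end UnivAlg

/-! ### Strict pseudo-inference algebras -/

/-- A Boolean algebra with a ternary weakly normal monotonic operator. -/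
class ThreeBAMO (A : Type u) extends BooleanAlgebra A where
  dia : A → A → A → A
  dia_bot_left : ∀ b c : A, dia ⊥ b c = ⊥
  dia_bot_mid : ∀ a c : A, dia a ⊥ c = ⊥
  dia_bot_right : ∀ a b : A, dia a b ⊥ = ⊥
  dia_sup_left : ∀ a x b c : A, dia (a ⊔ x) b c = dia a b c ⊔ dia x b c
  dia_sup_mid : ∀ a b x c : A, dia a (b ⊔ x) c = dia a b c ⊔ dia a x c
  dia_sup_right : ∀ a b c x : A, dia a b c ⊔ dia a b x ≤ dia a b (c ⊔ x)

/-- A pseudo-inference algebra. -/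
class PSIAlgebra (A : Type u) extends ThreeBAMO A where
  pi1 : ∀ a b d e f : A, dia a b f ≤ dia a b dᶜ ⊔ dia a b eᶜ ⊔ dia d e f
  pi2 : ∀ a b : A, dia a b aᶜ = ⊥
  pi3 : ∀ a f : A, a ⊓ f ≤ dia a a f
  pi4 : ∀ a b f : A, dia a b f ≤ dia b a f

/-- The operator `μ(z) = ¬◇(1,1,¬z) ∧ ¬◇(1,¬z,1)`. -/
def ThreeBAMO.mu {A : Type u} [ThreeBAMO A] (z : A) : A :=
  (dia ⊤ ⊤ zᶜ)ᶜ ⊓ (dia ⊤ zᶜ ⊤)ᶜ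

/-- A strict pseudo-inference algebra. -/
class StrictPSIAlgebra (A : Type u) extends PSIAlgebra A where
  r1 : ∀ x y a b : A, dia x y a ⊓ (dia x y b)ᶜ ≤ dia ⊤ ⊤ (a ⊓ bᶜ)
  r2 : ∀ x y a b : A, dia x a y ⊓ (dia x b y)ᶜ ≤ dia ⊤ (a ⊓ bᶜ) ⊤
  s : ∀ a b c : A, dia a b c ≤ ThreeBAMO.mu (dia a b c)

/-- The operation symbols `∨, ∧, ¬, 0, 1, ◇` with their arities. -/
inductive PSIOp : ℕ → Type
  | sup : PSIOp 2
  | inf : PSIOp 2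
  | neg : PSIOp 1
  | bot : PSIOp 0
  | top : PSIOp 0
  | dia : PSIOp 3

/-- The algebraic language of pseudo-inference algebras. -/
def psiLanguage : FirstOrder.Language.{0, 0} where
  Functions := PSIOp
  Relations := fun _ => Empty

/-- The algebra `(A, ∨, ∧, ¬, 0, 1, ◇)` as a structure for the language. -/
@[reducible]
def psiStructure (A : Type u) [ThreeBAMO A] : psiLanguage.Structure A where
  funMap := fun {_} f => match f with
    | PSIOp.sup => fun v => v 0 ⊔ v 1
    | PSIOp.inf => fun v => v 0 ⊓ v 1
    | PSIOp.neg => fun v => (v 0)ᶜ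
    | PSIOp.bot => fun _ => ⊥
    | PSIOp.top => fun _ => ⊤
    | PSIOp.dia => fun v => ThreeBAMO.dia (v 0) (v 1) (v 2)
  RelMap := fun r => r.elim

/-- The variety `SPSI` of strict pseudo-inference algebras. -/
def SPSI : Set (CategoryTheory.Bundled.{u} psiLanguage.Structure) :=
  {A | ∃ _ : StrictPSIAlgebra A, A.str = psiStructure A}

/-! The operator `mu` is an `S5` necessity, and `r1`, `r2` and `pi4` make `dia` respect, below `mu
f`, any agreement of arguments below `f`. Hence agreement below a member of a `mu`-closed filter
base is a congruence (`congruenceOfBase`). Since `mu z ≤ mu (mu z)`, the up-set of `mu (a ⇔ b)` is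
such a base; it yields Cg(a, b), so a single equation defines principal congruences. For the
extension property, the 1-class of a congruence of the subalgebra serves as a base in the whole
algebra. Arithmeticity needs only the Boolean reduct: ternary sum is a Mal'cev term, and majority
gives distributivity. -/

open FirstOrder.Language (Term Structure HomClass.realize_term)
open scoped symmDiff

namespace UnivAlg.Congruence

variable {L : FirstOrder.Language.{0, 0}} {A : Type u} [L.Structure A]

/-- Congruences are compatible with all term operations. -/
theorem realize_term (θ : Congruence L A) {α : Type*} (t : L.Term α) {v w : α → A}
    (h : ∀ i, θ.toSetoid (v i) (w i)) : θ.toSetoid (t.realize v) (t.realize w) := by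
  induction t with
  | var i => exact h i
  | func f ts ih => exact θ.compatible f _ _ ih

/-- The join of two congruences that permute is their composition. -/
theorem sup_iff_comp (θ φ : Congruence L A)
    (h : Relation.Comp (⇑θ.toSetoid) (⇑φ.toSetoid) = Relation.Comp (⇑φ.toSetoid) (⇑θ.toSetoid))
    (a b : A) :
    (θ ⊔ φ).toSetoid a b ↔ ∃ w, θ.toSetoid a w ∧ φ.toSetoid w b := by
  let ψ : Congruence L A :=
    { r := Relation.Comp (⇑θ.toSetoid) (⇑φ.toSetoid)
      iseqv :=
        { refl := fun x => ⟨x, θ.refl x, φ.refl x⟩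
          symm := by
            rintro x y ⟨w, hx, hy⟩
            rw [h]
            exact ⟨w, φ.symm hy, θ.symm hx⟩
          trans := by
            rintro x y z ⟨w, hxw, hwy⟩ ⟨w', hyw, hwz⟩
            have hw : Relation.Comp (⇑θ.toSetoid) (⇑φ.toSetoid) w w' := by
              rw [h]
              exact ⟨y, hwy, hyw⟩
            obtain ⟨s, hs, hs'⟩ := hw
            exact ⟨s, θ.trans hxw hs, φ.trans hs' hwz⟩ }
      compatible := by
        intro n f x y hxy
        choose w hw hw' using hxy
        exact ⟨Structure.funMap f w, θ.compatible f x w hw, φ.compatible f w y hw'⟩ }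
  constructor
  · have hθ : θ ≤ ψ := fun x y hxy => ⟨y, hxy, φ.refl y⟩
    have hφ : φ ≤ ψ := fun x y hxy => ⟨x, θ.refl x, hxy⟩
    exact fun hab => sup_le hθ hφ hab
  · rintro ⟨w, haw, hwb⟩
    have hθ : θ ≤ θ ⊔ φ := le_sup_left
    have hφ : φ ≤ θ ⊔ φ := le_sup_right
    exact (θ ⊔ φ).trans (hθ haw) (hφ hwb)

theorem principal_iff {a b c d : A} :
    (principal L a b).toSetoid c d ↔ ∀ θ : Congruence L A, θ.toSetoid a b → θ.toSetoid c d := by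
  constructor
  · intro h θ hθ
    exact h _ ⟨θ, hθ, rfl⟩
  · rintro h _ ⟨θ, hθ, rfl⟩
    exact h θ hθ

end UnivAlg.Congruence

attribute [local instance] psiStructure

/-! ### The operator `mu` and congruences from `mu`-closed bases. -/

namespace StrictPSIAlgebra

open ThreeBAMO PSIAlgebra UnivAlg

variable {A : Type u}

section ThreeBAMO

variable [ThreeBAMO A]

theorem dia_mono_mid (a c : A) {b b' : A} (h : b ≤ b') : dia a b c ≤ dia a b' c := by
  rw [← sup_eq_right.2 h, dia_sup_mid]
  exact le_sup_left

theorem dia_mono_left (b c : A) {a a' : A} (h : a ≤ a') : dia a b c ≤ dia a' b c := by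
  rw [← sup_eq_right.2 h, dia_sup_left]
  exact le_sup_left

theorem dia_mono_right (a b : A) {c c' : A} (h : c ≤ c') : dia a b c ≤ dia a b c' := by
  rw [← sup_eq_right.2 h]
  exact le_sup_left.trans (dia_sup_right a b c c')

theorem mu_mono : Monotone (mu : A → A) := fun _ _ h =>
  inf_le_inf (compl_le_compl (dia_mono_right _ _ (compl_le_compl h)))
    (compl_le_compl (dia_mono_mid _ _ (compl_le_compl h)))

theorem mu_top : mu (⊤ : A) = ⊤ := by
  simp [mu, dia_bot_right, dia_bot_mid]

end ThreeBAMO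

theorem mu_le [PSIAlgebra A] (z : A) : mu z ≤ z := by
  have h : zᶜ ≤ dia ⊤ ⊤ zᶜ :=
    calc zᶜ = zᶜ ⊓ zᶜ := by simp
      _ ≤ dia zᶜ zᶜ zᶜ := pi3 _ _
      _ ≤ dia ⊤ zᶜ zᶜ := dia_mono_left _ _ le_top
      _ ≤ dia ⊤ ⊤ zᶜ := dia_mono_mid _ _ le_top
  exact inf_le_left.trans (compl_le_iff_compl_le.1 h)

variable [StrictPSIAlgebra A]

/-- The operator `μ` is an `S5` necessity operator; this is its transitivity axiom. -/
theorem mu_le_mu_mu (z : A) : mu z ≤ mu (mu z) := by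
  -- Axiom 5: the complement of `mu w` is a join of two values of `dia`, and `s` puts each below its
  -- own `mu`.
  have h5 (w : A) : (mu w)ᶜ ≤ mu (mu w)ᶜ := by
    have hw : (mu w)ᶜ = dia ⊤ ⊤ wᶜ ⊔ dia ⊤ wᶜ ⊤ := by simp [mu, compl_inf]
    rw [hw]
    exact sup_le ((s _ _ _).trans (mu_mono le_sup_left)) ((s _ _ _).trans (mu_mono le_sup_right))
  -- Axiom B comes from T (`mu_le`); transitivity then follows from B and two uses of 5, as in modal
  -- logic.
  have hB : mu z ≤ (mu (mu z)ᶜ)ᶜ := le_compl_comm.1 (mu_le _)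
  exact (hB.trans (h5 _)).trans (mu_mono (compl_le_iff_compl_le.1 (h5 z)))

/-- By `r1`, what `dia x y a` has outside `dia x y b` lies below `dia ⊤ ⊤ fᶜ`, which is disjoint
from `mu f`. -/
theorem mu_inf_dia_right_le {f a b : A} (x y : A) (h : f ⊓ a ≤ b) :
    mu f ⊓ dia x y a ≤ dia x y b := by
  have h1 : a ⊓ bᶜ ≤ fᶜ := by
    rw [← sdiff_eq, sdiff_le_iff, ← himp_eq, le_himp_iff, inf_comm]
    exact h
  have h2 := (r1 x y a b).trans (dia_mono_right _ _ h1)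
  rw [← sdiff_eq, sdiff_le_iff] at h2
  calc mu f ⊓ dia x y a ≤ (dia ⊤ ⊤ fᶜ)ᶜ ⊓ (dia x y b ⊔ dia ⊤ ⊤ fᶜ) := inf_le_inf inf_le_left h2
    _ = (dia ⊤ ⊤ fᶜ)ᶜ ⊓ dia x y b := by simp [inf_sup_left]
    _ ≤ dia x y b := inf_le_right

theorem mu_inf_dia_mid_le {f a b : A} (x y : A) (h : f ⊓ a ≤ b) :
    mu f ⊓ dia x a y ≤ dia x b y := by
  have h1 : a ⊓ bᶜ ≤ fᶜ := by
    rw [← sdiff_eq, sdiff_le_iff, ← himp_eq, le_himp_iff, inf_comm]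
    exact h
  have h2 := (r2 x y a b).trans (dia_mono_mid _ _ h1)
  rw [← sdiff_eq, sdiff_le_iff] at h2
  calc mu f ⊓ dia x a y ≤ (dia ⊤ fᶜ ⊤)ᶜ ⊓ (dia x b y ⊔ dia ⊤ fᶜ ⊤) := inf_le_inf inf_le_right h2
    _ = (dia ⊤ fᶜ ⊤)ᶜ ⊓ dia x b y := by simp [inf_sup_left]
    _ ≤ dia x b y := inf_le_right

/-- No axiom like `r2` treats the first argument; the symmetry `pi4` moves it to the middle and
back. -/
theorem mu_inf_dia_left_le {f a b : A} (x y : A) (h : f ⊓ a ≤ b) :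
    mu f ⊓ dia a x y ≤ dia b x y :=
  (inf_le_inf_left _ (pi4 _ _ _)).trans ((mu_inf_dia_mid_le x y h).trans (pi4 _ _ _))

theorem mu_inf_dia_le {f a b c a' b' c' : A} (ha : f ⊓ a ≤ a') (hb : f ⊓ b ≤ b')
    (hc : f ⊓ c ≤ c') : mu f ⊓ dia a b c ≤ dia a' b' c' :=
  (le_inf inf_le_left ((le_inf inf_le_left (mu_inf_dia_left_le _ _ ha)).trans
    (mu_inf_dia_mid_le _ _ hb))).trans (mu_inf_dia_right_le _ _ hc)

theorem mu_inf_dia_eq {f a b c a' b' c' : A} (ha : f ⊓ a = f ⊓ a') (hb : f ⊓ b = f ⊓ b')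
    (hc : f ⊓ c = f ⊓ c') : mu f ⊓ dia a b c = mu f ⊓ dia a' b' c' :=
  le_antisymm
    (le_inf inf_le_left (mu_inf_dia_le (ha.trans_le inf_le_right) (hb.trans_le inf_le_right)
      (hc.trans_le inf_le_right)))
    (le_inf inf_le_left (mu_inf_dia_le (ha.symm.trans_le inf_le_right)
      (hb.symm.trans_le inf_le_right) (hc.symm.trans_le inf_le_right)))

theorem inf_eq_inf_of_le {f g a b : A} (h : g ≤ f) (hf : f ⊓ a = f ⊓ b) : g ⊓ a = g ⊓ b := by
  rw [← inf_eq_left.2 h, inf_assoc, hf, inf_assoc]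

theorem inf_compl_congr {f a b : A} (h : f ⊓ a = f ⊓ b) : f ⊓ aᶜ = f ⊓ bᶜ := by
  have key (c : A) : f ⊓ cᶜ = f ⊓ (f ⊓ c)ᶜ := by simp [compl_inf, inf_sup_left]
  rw [key a, h, ← key b]

/-- The congruence given by a filter base closed under `μ`: two elements are related when they
agree below some element of the base. -/
def congruenceOfBase (F : Set A) (top : ⊤ ∈ F) (inf : ∀ f ∈ F, ∀ g ∈ F, f ⊓ g ∈ F)
    (hmu : ∀ f ∈ F, mu f ∈ F) : Congruence psiLanguage A :=
  { r := fun a b => ∃ f ∈ F, f ⊓ a = f ⊓ b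
    iseqv :=
      { refl := fun a => ⟨⊤, top, rfl⟩
        symm := fun ⟨f, hf, h⟩ => ⟨f, hf, h.symm⟩
        trans := fun ⟨f, hf, h⟩ ⟨g, hg, h'⟩ => ⟨f ⊓ g, inf f hf g hg,
          (inf_eq_inf_of_le inf_le_left h).trans (inf_eq_inf_of_le inf_le_right h')⟩ }
    compatible := by
      intro n f x y h
      cases f with
      | sup =>
        obtain ⟨f, hf, h0⟩ := h 0
        obtain ⟨g, hg, h1⟩ := h 1
        refine ⟨f ⊓ g, inf f hf g hg, ?_⟩
        change f ⊓ g ⊓ (x 0 ⊔ x 1) = f ⊓ g ⊓ (y 0 ⊔ y 1)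
        rw [inf_sup_left, inf_sup_left, inf_eq_inf_of_le inf_le_left h0,
          inf_eq_inf_of_le inf_le_right h1]
      | inf =>
        obtain ⟨f, hf, h0⟩ := h 0
        obtain ⟨g, hg, h1⟩ := h 1
        refine ⟨f ⊓ g, inf f hf g hg, ?_⟩
        change f ⊓ g ⊓ (x 0 ⊓ x 1) = f ⊓ g ⊓ (y 0 ⊓ y 1)
        rw [inf_inf_inf_comm, h0, h1, inf_inf_inf_comm]
      | neg =>
        obtain ⟨f, hf, h0⟩ := h 0
        exact ⟨f, hf, inf_compl_congr h0⟩
      | bot => exact ⟨⊤, top, rfl⟩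
      | top => exact ⟨⊤, top, rfl⟩
      | dia =>
        obtain ⟨f, hf, h0⟩ := h 0
        obtain ⟨g, hg, h1⟩ := h 1
        obtain ⟨k, hk, h2⟩ := h 2
        exact ⟨mu (f ⊓ g ⊓ k), hmu _ (inf _ (inf f hf g hg) k hk),
          mu_inf_dia_eq (inf_eq_inf_of_le (inf_le_left.trans inf_le_left) h0)
            (inf_eq_inf_of_le (inf_le_left.trans inf_le_right) h1)
            (inf_eq_inf_of_le inf_le_right h2)⟩ }

end StrictPSIAlgebra

/-! ### Terms in the language of pseudo-inference algebras -/

namespace PSITerm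

variable {α : Type}

def sup (s t : psiLanguage.Term α) : psiLanguage.Term α :=
  .func (l := 2) PSIOp.sup ![s, t]

def inf (s t : psiLanguage.Term α) : psiLanguage.Term α :=
  .func (l := 2) PSIOp.inf ![s, t]

def neg (t : psiLanguage.Term α) : psiLanguage.Term α :=
  .func (l := 1) PSIOp.neg ![t]

def top : psiLanguage.Term α :=
  .func (l := 0) PSIOp.top ![]

def dia (r s t : psiLanguage.Term α) : psiLanguage.Term α :=
  .func (l := 3) PSIOp.dia ![r, s, t]

/-- The Boolean equivalence of two terms. -/
def iff (s t : psiLanguage.Term α) : psiLanguage.Term α :=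
  sup (inf s t) (inf (neg s) (neg t))

def mu (t : psiLanguage.Term α) : psiLanguage.Term α :=
  inf (neg (dia top top (neg t))) (neg (dia top (neg t) top))

/-- The ternary sum of three terms in the Boolean ring. -/
def ternarySum (r s t : psiLanguage.Term α) : psiLanguage.Term α :=
  iff (iff r s) t

/-- The majority of three terms. -/
def maj (r s t : psiLanguage.Term α) : psiLanguage.Term α :=
  sup (inf r s) (sup (inf s t) (inf r t))

variable {A : Type u} [ThreeBAMO A] (v : α → A) (r s t : psiLanguage.Term α)

theorem realize_sup : (sup s t).realize v =
    s.realize v ⊔ t.realize v := rfl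

theorem realize_inf : (inf s t).realize v =
    s.realize v ⊓ t.realize v := rfl

theorem realize_neg : (neg t).realize v =
    (t.realize v)ᶜ := rfl

theorem realize_mu : (mu t).realize v =
    ThreeBAMO.mu (t.realize v) := rfl

theorem realize_iff : (iff s t).realize v =
    s.realize v ⇔ t.realize v := by
  rw [iff, realize_sup, realize_inf, realize_inf, realize_neg, realize_neg, bihimp_eq']

theorem realize_ternarySum : (ternarySum r s t).realize v =
    (r.realize v ⇔ s.realize v) ⇔
      t.realize v := by
  rw [ternarySum, realize_iff, realize_iff]

end PSITerm

/-! ### Principal congruences, extension, permutability, distributivity. -/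

namespace StrictPSIAlgebra

open ThreeBAMO UnivAlg

variable {A : Type u} [StrictPSIAlgebra A]

theorem bihimp_inf_eq (a b : A) : (a ⇔ b) ⊓ a = (a ⇔ b) ⊓ b := by
  apply le_antisymm <;> refine le_inf inf_le_left ?_
  · rw [inf_comm]
    exact (le_bihimp_iff.1 (le_refl (a ⇔ b))).2
  · rw [inf_comm]
    exact (le_bihimp_iff.1 (le_refl (a ⇔ b))).1

/-- Left to right, the base is the up-set of `mu (a ⇔ b)`. Conversely, a congruence identifying `a`
with `b` identifies `mu (a ⇔ b)` with `mu (b ⇔ b) = ⊤`. -/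
theorem principal_iff (a b c d : A) :
    (Congruence.principal psiLanguage a b).toSetoid c d ↔
      mu (a ⇔ b) ⊓ c = mu (a ⇔ b) ⊓ d := by
  rw [Congruence.principal_iff]
  constructor
  · intro h
    obtain ⟨f, hf, hcd⟩ := h (congruenceOfBase (Set.Ici (mu (a ⇔ b))) le_top
      (fun f hf g hg => le_inf hf hg) (fun f hf => (mu_le_mu_mu _).trans (mu_mono hf)))
      ⟨mu (a ⇔ b), le_rfl, inf_eq_inf_of_le (mu_le _) (bihimp_inf_eq a b)⟩
    exact inf_eq_inf_of_le hf hcd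
  · intro h θ hab
    have key (z : A) : θ.toSetoid (mu (a ⇔ b) ⊓ z) z := by
      have := θ.realize_term (v := ![a, b, z]) (w := ![b, b, z])
        (PSITerm.inf (PSITerm.mu (PSITerm.iff (.var 0) (.var 1))) (.var 2)) (by
          intro i
          fin_cases i
          exacts [hab, θ.refl _, θ.refl _])
      simpa [PSITerm.realize_inf, PSITerm.realize_mu, PSITerm.realize_iff, mu_top] using this
    exact θ.trans (θ.symm (key c)) (h ▸ key d)

/-- Every congruence of a subalgebra extends to the whole algebra. -/
theorem exists_congruence_extension (S : psiLanguage.Substructure A)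
    (δ : Congruence psiLanguage S) : ∃ θ : Congruence psiLanguage A,
      ∀ x y : S, δ.toSetoid x y ↔ θ.toSetoid (x : A) (y : A) := by
  -- `S` carries no Boolean algebra instance, so its operations are written as terms and identities
  -- are checked in `A`.
  have coe_realize {n : ℕ} (t : psiLanguage.Term (Fin n)) (v : Fin n → S) :
      ((t.realize v : S) : A) = t.realize fun i => (v i : A) :=
    (HomClass.realize_term S.subtype (t := t) (v := v)).symm
  let one : S := (PSITerm.top : psiLanguage.Term (Fin 0)).realize ![]
  have coe_one : (one : A) = ⊤ := coe_realize PSITerm.top ![]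
  have eq_one {x : S} (h : (x : A) = ⊤) : x = one := Subtype.ext (h.trans coe_one.symm)
  -- The 1-class of `δ` viewed in `A`; it need not be upward closed there.
  let F : Set A := {a | ∃ x : S, δ.toSetoid x one ∧ (x : A) = a}
  refine ⟨congruenceOfBase F ⟨one, δ.refl _, coe_one⟩ ?_ ?_, fun x y => ⟨fun h => ?_, ?_⟩⟩
  · rintro _ ⟨x, hx, rfl⟩ _ ⟨y, hy, rfl⟩
    let t : psiLanguage.Term (Fin 2) := PSITerm.inf (.var 0) (.var 1)
    refine ⟨t.realize ![x, y], ?_, by simp [coe_realize, t, PSITerm.realize_inf]⟩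
    have h := δ.realize_term t (v := ![x, y]) (w := ![one, one]) (by
      intro i
      fin_cases i
      exacts [hx, hy])
    rwa [eq_one (x := t.realize ![one, one])
      (by simp [coe_realize, t, PSITerm.realize_inf, coe_one])] at h
  · rintro _ ⟨x, hx, rfl⟩
    let t : psiLanguage.Term (Fin 1) := PSITerm.mu (.var 0)
    refine ⟨t.realize ![x], ?_, by simp [coe_realize, t, PSITerm.realize_mu]⟩
    have h := δ.realize_term t (v := ![x]) (w := ![one]) (by
      intro i
      fin_cases i
      exact hx)
    rwa [eq_one (x := t.realize ![one])
      (by simp [coe_realize, t, PSITerm.realize_mu, coe_one, mu_top])] at h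
  · let t : psiLanguage.Term (Fin 2) := PSITerm.iff (.var 0) (.var 1)
    refine ⟨(x : A) ⇔ y, ⟨t.realize ![x, y], ?_, by simp [coe_realize, t, PSITerm.realize_iff]⟩,
      bihimp_inf_eq _ _⟩
    have h := δ.realize_term t (v := ![x, y]) (w := ![y, y]) (by
      intro i
      fin_cases i
      exacts [h, δ.refl _])
    rwa [eq_one (x := t.realize ![y, y])
      (by simp [coe_realize, t, PSITerm.realize_iff])] at h
  · rintro ⟨_, ⟨f, hf, rfl⟩, hxy⟩
    let t : psiLanguage.Term (Fin 2) := PSITerm.inf (.var 0) (.var 1)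
    have key (z : S) : δ.toSetoid (t.realize ![f, z]) z := by
      have h := δ.realize_term t (v := ![f, z]) (w := ![one, z]) (by
        intro i
        fin_cases i
        exacts [hf, δ.refl _])
      rwa [show t.realize ![one, z] = z from
        Subtype.ext (by simp [coe_realize, t, PSITerm.realize_inf, coe_one])] at h
    have hfxy : t.realize ![f, x] = t.realize ![f, y] :=
      Subtype.ext (by simpa [coe_realize, t, PSITerm.realize_inf] using hxy)
    exact δ.trans (δ.symm (key x)) (hfxy ▸ key y)

/-- Mal'cev's argument: the ternary sum satisfies `t(x, z, z) = x` and `t(y, y, z) = z`, so `t(x, y,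
z)` is the new intermediate element. -/
theorem comp_le_comp (θ φ : Congruence psiLanguage A) (x z : A)
    (h : Relation.Comp (⇑θ.toSetoid) (⇑φ.toSetoid) x z) :
    Relation.Comp (⇑φ.toSetoid) (⇑θ.toSetoid) x z := by
  obtain ⟨y, hxy, hyz⟩ := h
  let t : psiLanguage.Term (Fin 3) := PSITerm.ternarySum (.var 0) (.var 1) (.var 2)
  have h1 := φ.realize_term t (v := ![x, z, z]) (w := ![x, y, z]) (by
    intro i
    fin_cases i
    exacts [φ.refl _, φ.symm hyz, φ.refl _])
  have h2 := θ.realize_term t (v := ![x, y, z]) (w := ![y, y, z]) (by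
    intro i
    fin_cases i
    exacts [hxy, θ.refl _, θ.refl _])
  refine ⟨t.realize ![x, y, z], ?_, ?_⟩
  · simpa [t, PSITerm.realize_ternarySum] using h1
  · simpa [t, PSITerm.realize_ternarySum] using h2

theorem comp_comm (θ φ : Congruence psiLanguage A) :
    Relation.Comp (⇑θ.toSetoid) (⇑φ.toSetoid) = Relation.Comp (⇑φ.toSetoid) (⇑θ.toSetoid) := by
  funext x z
  exact propext ⟨comp_le_comp θ φ x z, comp_le_comp φ θ x z⟩

/-- By permutability the join has one intermediate `w`. Replacing it by the majority of `a`, `w`,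
`b` keeps the `φ` and `ψ` links and makes both links lie in `θ`. -/
theorem congruence_inf_sup_left (θ φ ψ : Congruence psiLanguage A) :
    θ ⊓ (φ ⊔ ψ) = (θ ⊓ φ) ⊔ (θ ⊓ ψ) := by
  refine le_antisymm (fun a b hab => ?_) le_inf_sup
  have hθ : θ.toSetoid a b := (inf_le_left : θ ⊓ (φ ⊔ ψ) ≤ θ) hab
  have hsup : (φ ⊔ ψ).toSetoid a b := (inf_le_right : θ ⊓ (φ ⊔ ψ) ≤ φ ⊔ ψ) hab
  -- The meet is accessed through its universal property, tested on a principal congruence.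
  have inf_intro {η : Congruence psiLanguage A} {x y : A} (h : θ.toSetoid x y)
      (h' : η.toSetoid x y) : (θ ⊓ η).toSetoid x y := by
    have : Congruence.principal psiLanguage x y ≤ θ ⊓ η :=
      le_inf (fun _ _ hp => Congruence.principal_iff.1 hp θ h)
        (fun _ _ hp => Congruence.principal_iff.1 hp η h')
    exact this (Congruence.principal_iff.2 fun _ h => h)
  obtain ⟨w, haw, hwb⟩ := (φ.sup_iff_comp ψ (comp_comm φ ψ) a b).1 hsup
  let t : psiLanguage.Term (Fin 3) := PSITerm.maj (.var 0) (.var 1) (.var 2)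
  have ht (x y z : A) : t.realize ![x, y, z] = x ⊓ y ⊔ (y ⊓ z ⊔ x ⊓ z) := rfl
  have hc (η : Congruence psiLanguage A) {x y z x' y' z' : A} (hx : η.toSetoid x x')
      (hy : η.toSetoid y y') (hz : η.toSetoid z z') :
      η.toSetoid (t.realize ![x, y, z]) (t.realize ![x', y', z']) :=
    η.realize_term t (by
      intro i
      fin_cases i
      exacts [hx, hy, hz])
  have haab : t.realize ![a, a, b] = a := by simp [ht]
  have habb : t.realize ![a, b, b] = b := by simp [ht]
  have hawa : t.realize ![a, w, a] = a := by simp [ht, inf_comm w a]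
  have hm : θ.toSetoid a (t.realize ![a, w, b]) := by
    have := hc θ (θ.refl a) (θ.refl w) hθ
    rwa [hawa] at this
  refine (Congruence.sup_iff_comp _ _ (comp_comm _ _) a b).2
    ⟨t.realize ![a, w, b], inf_intro hm ?_, inf_intro (θ.trans (θ.symm hm) hθ) ?_⟩
  · have := hc φ (φ.refl a) haw (φ.refl b)
    rwa [haab] at this
  · have := hc ψ (ψ.refl a) hwb (ψ.refl b)
    rwa [habb] at this

end StrictPSIAlgebra

theorem forall_mem_SPSI {P : CategoryTheory.Bundled.{u} psiLanguage.Structure → Prop}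
    (h : ∀ (A : Type u) [StrictPSIAlgebra A], P ⟨A, psiStructure A⟩) : ∀ A ∈ SPSI, P A := by
  rintro ⟨A, str⟩ ⟨inst, hstr⟩
  change StrictPSIAlgebra A at inst
  obtain rfl : str = psiStructure A := hstr
  exact h A

theorem mainTheorem6 :
    UnivAlg.HasCEP SPSI.{u} ∧ UnivAlg.HasEDPC SPSI.{u} ∧ UnivAlg.IsArithmetical SPSI.{u} := by
  refine ⟨?_, ?_, ?_, ?_⟩
  · refine forall_mem_SPSI fun B _ => ?_
    intro S δ
    exact StrictPSIAlgebra.exists_congruence_extension S δ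
  · let e : psiLanguage.Term (Fin 4) := PSITerm.mu (PSITerm.iff (.var 0) (.var 1))
    refine ⟨[(PSITerm.inf e (.var 2), PSITerm.inf e (.var 3))], ?_⟩
    refine forall_mem_SPSI fun A _ => ?_
    intro a b c d
    refine (StrictPSIAlgebra.principal_iff a b c d).trans ?_
    simp [e, PSITerm.realize_inf, PSITerm.realize_mu, PSITerm.realize_iff]
  · refine forall_mem_SPSI fun A _ => ?_
    intro θ φ ψ
    exact StrictPSIAlgebra.congruence_inf_sup_left θ φ ψ
  · refine forall_mem_SPSI fun A _ => ?_
    intro θ φ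
    exact StrictPSIAlgebra.comp_comm θ φ
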